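/- Let $X$ be a topological space in which compact sets are Borel (no separation axiom is assumed), let $(\mu_\alpha)$ be a net of Borel probability measures on $X$ and $(t_\alpha)$ a net (over the same directed set) in $]0,+\infty[$ converging to $0$. Let $\mathcal{F},\mathcal{G},\mathcal{K}$ be the families of closed, open and compact subsets of $X$. *Notation.* Put $\mu_\alpha^{t_\alpha}(A)=(\mu_\alpha(A))^{t_\alpha}$. For a Borel function $h:X\to[-\infty,+\infty[$ put $\mu_\alpha^{t_\alpha}(e^{h/t_\alpha})=\big(\int_X e^{h/t_\alpha}\,d\mu_\alpha\big)^{t_\alpha}$, $\overline\Lambda(h)=\log\limsup\mu_\alpha^{t_\alpha}(e^{h/t_\alpha})$, $\underline\Lambda(h)=\log\liminf\mu_\alpha^{t_\alpha}(e^{h/t_\alpha})$, and $\Lambda(h)=\log\lim\mu_\alpha^{t_\alpha}(e^{h/t_\alpha})$ when the limit exists in $[0,+\infty]$ (then "$\Lambda(h)$ exists"). Let $h_M=h$ on $\{h<M\}$ and $h_M=-\infty$ on $\{h\ge M\}$. Let $X_0$ be the set of $x\in X$ such that for each $G\in\mathcal{G}$ containing $x$ and all reals $s,t>0$ there is a bounded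 continuous $h:X\to\mathbb{R}$ with $$e^{-t}1_{\{x\}}\le e^{h}\le 1_G\vee e^{-s}.\qquad(*)$$ A set $\mathcal{T}$ of continuous functions $X\to[-\infty,+\infty[$ is an *approximating class* if for each $x\in X_0$, each $G\in\mathcal{G}$ containing $x$ and all reals $s,t>0$, some $h\in\mathcal{T}$ satisfies $(*)$. Let $\mathcal{T}_-=\{h\in\mathcal{T}:h\le 0\}$, let $\mathcal{T}^T$ be the set of $h\in\mathcal{T}$ with $\lim_{M\to+\infty}\limsup\mu_\alpha^{t_\alpha}(e^{h/t_\alpha}1_{\{e^h\ge M\}})=0$, and for $G\in\mathcal{G}$, $s>0$ let $$\mathcal{T}_{G,s}=\bigcup_{x\in G\cap X_0,\,t>0}\{h\in\mathcal{T}:e^h\le 1_G\vee e^{-s},\ h(x)\ge -t\}.$$ Define (with $\inf\emptyset=+\infty$) $$l_{\mathcal{T}}(x)=\begin{cases}\inf_{t>0}\ \sup_{h\in\mathcal{T}^T,\,h(x)\ge -t}\{-\overline\Lambda(h)\}& x\in X_0,\\[2pt] \sup_{G\in\mathcal{G},\,G\ni x}\ \sup_{s>0}\ \inf_{h\in\mathcal{T}_{G,s}}\{-\overline\Lambda(h)\}&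 x\in X\setminus X_0,\end{cases}$$ $$l_0(x)=-\log\inf\{\limsup\mu_\alpha^{t_\alpha}(G):G\in\mathcal{G},\ G\ni x\}.$$ $(\mu_\alpha)$ satisfies a *large deviation principle* with powers $(t_\alpha)$ and *rate function* $J$ if there is $l:X\to[0,+\infty]$ with $\limsup\mu_\alpha^{t_\alpha}(F)\le\sup_{F}e^{-l}$ for all $F\in\mathcal{F}$ and $\sup_{G}e^{-l}\le\liminf\mu_\alpha^{t_\alpha}(G)$ for all $G\in\mathcal{G}$, and $J$ is the greatest lower semicontinuous function $\le l$. $(\mu_\alpha)$ is *exponentially tight* (resp. *$X_0$-exponentially tight*) with respect to $(t_\alpha)$ if for each $\varepsilon>0$ there is a compact $K\subset X$ (resp. a compact $K\subset X_0$) with $\limsup\mu_\alpha^{t_\alpha}(X\setminus K)<\varepsilon$. **Proposition.** Consider the following statements. (i) $(\mu_\alpha)$ is $X_0$-exponentially tight with respect to $(t_\alpha)$. (ii) $(\mu_\alpha)$ is exponentially tight with respect to $(t_\alpha)$, and $l_0=+\infty$ on $X\setminus X_0$. (iii) For every $F\in\mathcal{F}$, every family $\{G_i:i\in I\}$ of open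 sets covering $F\cap X_0$, and every $\varepsilon>0$, there is a finite (possibly empty) set $\{G_{i_1},\dots,G_{i_N}\}\subset\{G_i:i\in I\}$ with $$\limsup\mu_\alpha^{t_\alpha}(F)-\limsup\mu_\alpha^{t_\alpha}\Big(\bigcup_{1\le j\le N}\overline{G_{i_j}}\Big)<\varepsilon.$$ (a) (i) implies (iii); (ii) implies (iii); and (i) implies (ii) when $\mathcal{K}\subset\mathcal{F}$. (b) Suppose that (iii) holds and that $\Lambda(h)$ exists for all $h\in\mathcal{T}_-$, where $\mathcal{T}$ is an approximating class. Then $(\mu_\alpha)$ satisfies a large deviation principle with powers $(t_\alpha)$ and rate function $l_{\mathcal{T}}$. Moreover $l_{\mathcal{T}}=l_{\mathcal{T}_-}$; for each $h\in\mathcal{T}$ the limit $\lim_{M\to+\infty}-\underline\Lambda(h_M)$ exists in $[-\infty,+\infty]$; and for all $x\in X_0$ $$l_{\mathcal{T}}(x)=\inf_{t>0}\ \sup_{h\in\mathcal{T}_-,\,h(x)\ge -t}\{-\Lambda(h)\}=\inf_{t>0}\ \sup_{h\in\mathcal{T},\,h(x)\ge -t}\Big\{\lim_{M\to+\infty}-\underline\Lambda(h_M)\Big\}.$$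 If $(\mu_\alpha)$ satisfies the large deviation principle with powers $(t_\alpha)$ for only one rate function, then $$l_{\mathcal{T}}(x)=\sup_{G\in\mathcal{G},\,G\ni x}\ \inf_{y\in G\cap X_0}l_{\mathcal{T}}(y)\qquad\text{for all }x\in X.$$ -/

import Mathlib

open Filter Topology MeasureTheory Set
open scoped ENNReal BoundedContinuousFunction

noncomputable section

namespace LargeDev

/-- `e^{-t} 1_{{x}} ≤ e^h ≤ 1_G ∨ e^{-s}` pointwise, for an extended-real-valued `h`. -/
def Separates {X : Type*} (h : X → EReal) (x : X) (G : Set X) (s t : ℝ) : Prop :=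
  ∀ y, ({x} : Set X).indicator (fun _ => EReal.exp ((-t : ℝ) : EReal)) y ≤ EReal.exp (h y) ∧
    EReal.exp (h y) ≤ max (G.indicator (fun _ => (1 : ℝ≥0∞)) y) (EReal.exp ((-s : ℝ) : EReal))

/-- The set `X₀` of points that bounded continuous functions separate from the closed sets not
containing them. -/
def regPart (X : Type*) [TopologicalSpace X] : Set X :=
  {x | ∀ G : Set X, IsOpen G → x ∈ G → ∀ s : ℝ, 0 < s → ∀ t : ℝ, 0 < t →
    ∃ h : X →ᵇ ℝ, Separates (fun y => ((h y : ℝ) : EReal)) x G s t}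

/-- Approximating classes: sets of continuous functions with values in `[-∞, +∞[` that separate
the points of `X₀` from closed sets. -/
structure IsApproximatingClass {X : Type*} [TopologicalSpace X] (T : Set (X → EReal)) : Prop where
  continuous : ∀ h ∈ T, Continuous h
  ne_top : ∀ h ∈ T, ∀ x, h x ≠ ⊤
  approx : ∀ x ∈ regPart X, ∀ G : Set X, IsOpen G → x ∈ G → ∀ s : ℝ, 0 < s → ∀ t : ℝ, 0 < t →
    ∃ h ∈ T, Separates h x G s t

/-- The negative part of a class: its members that are `≤ 0` everywhere. -/
def negPart {X : Type*} (T : Set (X → EReal)) : Set (X → EReal) :=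
  {h | h ∈ T ∧ ∀ x, h x ≤ 0}

/-- `h_M`: equal to `h` on `{h < M}` and to `-∞` on `{h ≥ M}`. -/
def trunc {X : Type*} (h : X → EReal) (M : ℝ) : X → EReal :=
  fun x => if h x < (M : EReal) then h x else ⊥

/-- The union over `x ∈ G ∩ X₀` and `t > 0` of
`{h ∈ T : e^h ≤ 1_G ∨ e^{-s}, h(x) ≥ -t}`. -/
def classAt {X : Type*} [TopologicalSpace X] (T : Set (X → EReal)) (G : Set X) (s : ℝ) :
    Set (X → EReal) :=
  {h | ∃ x ∈ G ∩ regPart X, ∃ t : ℝ, 0 < t ∧ h ∈ T ∧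
    (∀ y, EReal.exp (h y) ≤
      max (G.indicator (fun _ => (1 : ℝ≥0∞)) y) (EReal.exp ((-s : ℝ) : EReal))) ∧
    ((-t : ℝ) : EReal) ≤ h x}

section Net

variable {X : Type*} [TopologicalSpace X] [MeasurableSpace X] {ι : Type*} [Preorder ι]

/-- `μ_α^{t_α}(A)`, that is `(μ_α A)^{t_α}`. -/
def powMeasure (μ : ι → Measure X) (t : ι → ℝ) (A : Set X) (α : ι) : ℝ≥0∞ :=
  (μ α A) ^ (t α)

/-- `limsup μ_α^{t_α}(A)`. -/
def limsupMeasure (μ : ι → Measure X) (t : ι → ℝ) (A : Set X) : ℝ≥0∞ :=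
  limsup (powMeasure μ t A) atTop

/-- `liminf μ_α^{t_α}(A)`. -/
def liminfMeasure (μ : ι → Measure X) (t : ι → ℝ) (A : Set X) : ℝ≥0∞ :=
  liminf (powMeasure μ t A) atTop

/-- `μ_α^{t_α}(e^{h / t_α})`, that is `(∫ e^{h / t_α} dμ_α)^{t_α}`. -/
def powIntegral (μ : ι → Measure X) (t : ι → ℝ) (h : X → EReal) (α : ι) : ℝ≥0∞ :=
  (∫⁻ x, EReal.exp (h x / ((t α : ℝ) : EReal)) ∂(μ α)) ^ (t α)

/-- `log limsup μ_α^{t_α}(e^{h / t_α})`. -/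
def LambdaUpper (μ : ι → Measure X) (t : ι → ℝ) (h : X → EReal) : EReal :=
  ENNReal.log (limsup (powIntegral μ t h) atTop)

/-- `log liminf μ_α^{t_α}(e^{h / t_α})`. -/
def LambdaLower (μ : ι → Measure X) (t : ι → ℝ) (h : X → EReal) : EReal :=
  ENNReal.log (liminf (powIntegral μ t h) atTop)

/-- `Λ(h)` exists: `μ_α^{t_α}(e^{h / t_α})` converges in `[0, +∞]`. -/
def LambdaExists (μ : ι → Measure X) (t : ι → ℝ) (h : X → EReal) : Prop :=
  ∃ c : ℝ≥0∞, Tendsto (powIntegral μ t h) atTop (𝓝 c)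

/-- `Λ(h) = log lim μ_α^{t_α}(e^{h / t_α})`; meaningful when `LambdaExists μ t h`. -/
def Lambda (μ : ι → Measure X) (t : ι → ℝ) (h : X → EReal) : EReal :=
  ENNReal.log (limUnder atTop (powIntegral μ t h))

/-- The tail condition: `limsup μ_α^{t_α}(e^{h / t_α} 1_{e^h ≥ M})` tends to `0` as `M → +∞`. -/
def TailCondition (μ : ι → Measure X) (t : ι → ℝ) (h : X → EReal) : Prop :=
  Tendsto (fun M : ℝ => limsup (fun α =>
      (∫⁻ x, ({y | ENNReal.ofReal M ≤ EReal.exp (h y)} : Set X).indicator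
        (fun y => EReal.exp (h y / ((t α : ℝ) : EReal))) x ∂(μ α)) ^ (t α)) atTop)
    atTop (𝓝 0)

/-- The members of `T` satisfying the tail condition. -/
def tailPart (μ : ι → Measure X) (t : ι → ℝ) (T : Set (X → EReal)) : Set (X → EReal) :=
  {h | h ∈ T ∧ TailCondition μ t h}

/-- The large deviation upper bounds with the function `l`. -/
def UpperBounds (μ : ι → Measure X) (t : ι → ℝ) (l : X → EReal) : Prop :=
  ∀ F : Set X, IsClosed F → limsupMeasure μ t F ≤ ⨆ x ∈ F, EReal.exp (-(l x))

/-- The large deviation lower bounds with the function `l`. -/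
def LowerBounds (μ : ι → Measure X) (t : ι → ℝ) (l : X → EReal) : Prop :=
  ∀ G : Set X, IsOpen G → ⨆ x ∈ G, EReal.exp (-(l x)) ≤ liminfMeasure μ t G

/-- A large deviation principle holds with rate function `J`: the upper and lower bounds hold
with some `[0, +∞]`-valued function `l`, and `J` is the lower regularization of `l`, the greatest
lower semicontinuous function below `l`. -/
def IsLDPWithRate (μ : ι → Measure X) (t : ι → ℝ) (J : X → EReal) : Prop :=
  ∃ l : X → EReal, (∀ x, 0 ≤ l x) ∧ UpperBounds μ t l ∧ LowerBounds μ t l ∧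
    IsGreatest {g : X → EReal | LowerSemicontinuous g ∧ ∀ x, g x ≤ l x} J

/-- `l₀(x) = -log inf {limsup μ_α^{t_α}(G) : G open, x ∈ G}`. -/
def lZero (μ : ι → Measure X) (t : ι → ℝ) (x : X) : EReal :=
  -ENNReal.log (⨅ (G : Set X) (_ : IsOpen G) (_ : x ∈ G), limsupMeasure μ t G)

open Classical in
/-- The function `l_T` associated with an approximating class `T`. -/
def lClass (μ : ι → Measure X) (t : ι → ℝ) (T : Set (X → EReal)) (x : X) : EReal :=
  if x ∈ regPart X then
    ⨅ (r : ℝ) (_ : 0 < r), ⨆ h ∈ {h ∈ tailPart μ t T | ((-r : ℝ) : EReal) ≤ h x},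
      -LambdaUpper μ t h
  else
    ⨆ (G : Set X) (_ : IsOpen G) (_ : x ∈ G) (s : ℝ) (_ : 0 < s), ⨅ h ∈ classAt T G s,
      -LambdaUpper μ t h

/-- Exponential tightness. -/
def ExpTight (μ : ι → Measure X) (t : ι → ℝ) : Prop :=
  ∀ ε : ℝ≥0∞, 0 < ε → ∃ K : Set X, IsCompact K ∧ limsupMeasure μ t Kᶜ < ε

/-- `X₀`-exponential tightness: the tightening compact sets lie in `X₀`. -/
def RegExpTight (μ : ι → Measure X) (t : ι → ℝ) : Prop :=
  ∀ ε : ℝ≥0∞, 0 < ε → ∃ K : Set X, IsCompact K ∧ K ⊆ regPart X ∧ limsupMeasure μ t Kᶜ < ε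

/-- The finite-subcover condition. For probability measures all the upper limits are at most `1`,
so `a < b + ε` is `a - b < ε`. -/
def CoverCondition (μ : ι → Measure X) (t : ι → ℝ) : Prop :=
  ∀ F : Set X, IsClosed F → ∀ 𝒢 : Set (Set X), (∀ G ∈ 𝒢, IsOpen G) → F ∩ regPart X ⊆ ⋃₀ 𝒢 →
    ∀ ε : ℝ≥0∞, 0 < ε → ∃ 𝒮 : Set (Set X), 𝒮 ⊆ 𝒢 ∧ 𝒮.Finite ∧
      limsupMeasure μ t F < limsupMeasure μ t (⋃ G ∈ 𝒮, closure G) + ε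

end Net

end LargeDev

end

/-! Everything is compared with two local functions, `lZero` (upper limits of open neighbourhoods)
and `lOne` (lower limits), where `lZero ≤ lOne`. If `h` is continuous and `h x ≥ -r`, Chebyshev's
inequality on the open set `{h > -2r}` gives `-LambdaUpper h ≤ 2r + lZero x` (`neg_LambdaUpper_le`).
Conversely, at a point of `X₀`, a separating `h ≤ 0` is very negative off a small neighbourhood `G`,
so its integral is governed by the mass of `G`; this bounds `lOne x` by a supremum of `-Λ(h)`
(`lOne_le_iSup`). When `Λ` exists on `T_-`, these bounds close up: `lOne`, `lZero` and the three
infima over `T^T`, `T_-` and `T` agree on `X₀`.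

The principle is proved with `lReg`, which is `lZero` on `X₀` and `+∞` elsewhere. The lower bounds
are then local, by `lOne = lZero`; the upper bounds come from the cover condition, since points of
`X₀` have neighbourhoods with small closure (`upperBounds_lReg`). The regularization of `lReg` is
`lRate`, and `lClass_eq_lRate` identifies it with `lClass`; off `X₀` this uses the upper bounds
again. -/

set_option linter.unusedSectionVars false

namespace LargeDev

/-! ### Sums raised to vanishing powers. -/

section Powers

variable {ι : Type*} {l : Filter ι} {t : ι → ℝ}

lemma add_rpow_le_two_rpow_mul_max (a b : ℝ≥0∞) {s : ℝ} (hs : 0 ≤ s) :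
    (a + b) ^ s ≤ 2 ^ s * max (a ^ s) (b ^ s) := by
  rw [← (ENNReal.monotone_rpow_of_nonneg hs).map_max, ← ENNReal.mul_rpow_of_nonneg _ _ hs]
  refine ENNReal.rpow_le_rpow ?_ hs
  rw [two_mul]
  exact add_le_add (le_max_left _ _) (le_max_right _ _)

lemma tendsto_two_rpow (ht0 : Tendsto t l (𝓝 0)) :
    Tendsto (fun α => (2 : ℝ≥0∞) ^ t α) l (𝓝 1) := by
  have h : Tendsto (fun α => ENNReal.ofReal ((2 : ℝ) ^ t α)) l
      (𝓝 (ENNReal.ofReal ((2 : ℝ) ^ (0 : ℝ)))) :=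
    ENNReal.tendsto_ofReal (tendsto_const_nhds.rpow ht0 (Or.inl two_ne_zero))
  simpa [← ENNReal.ofReal_rpow_of_pos (two_pos : (0 : ℝ) < 2)] using h

/-- The factor `2 ^ t α` lost in replacing a sum by a maximum tends to `1`. -/
lemma limsup_add_rpow_le [l.NeBot] (ht : ∀ α, 0 < t α) (ht0 : Tendsto t l (𝓝 0))
    (a b : ι → ℝ≥0∞) :
    limsup (fun α => (a α + b α) ^ t α) l ≤
      max (limsup (fun α => a α ^ t α) l) (limsup (fun α => b α ^ t α) l) := by
  have h1 := (tendsto_two_rpow ht0).limsup_eq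
  calc limsup (fun α => (a α + b α) ^ t α) l
      ≤ limsup ((fun α => (2 : ℝ≥0∞) ^ t α) * fun α => max (a α ^ t α) (b α ^ t α)) l :=
        limsup_le_limsup (Eventually.of_forall fun α =>
          add_rpow_le_two_rpow_mul_max _ _ (ht α).le)
    _ ≤ limsup (fun α => (2 : ℝ≥0∞) ^ t α) l * limsup (fun α => max (a α ^ t α) (b α ^ t α)) l :=
        ENNReal.limsup_mul_le' (Or.inl (by simp [h1])) (Or.inl (by simp [h1]))
    _ = _ := by rw [h1, one_mul, limsup_max]

/-- A lower limit does not commute with maxima in general; it does when one of the two terms is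
constant. -/
lemma liminf_add_rpow_le [l.NeBot] (ht : ∀ α, 0 < t α) (ht0 : Tendsto t l (𝓝 0))
    (a b : ι → ℝ≥0∞) (c : ℝ≥0∞) (hb : ∀ α, b α ^ t α = c) :
    liminf (fun α => (a α + b α) ^ t α) l ≤ max (liminf (fun α => a α ^ t α) l) c := by
  have h1 := (tendsto_two_rpow ht0).limsup_eq
  calc liminf (fun α => (a α + b α) ^ t α) l
      ≤ liminf ((fun α => (2 : ℝ≥0∞) ^ t α) * fun α => max c (a α ^ t α)) l :=
        liminf_le_liminf (Eventually.of_forall fun α => by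
          simpa [hb, max_comm] using add_rpow_le_two_rpow_mul_max (a α) (b α) (ht α).le)
    _ ≤ limsup (fun α => (2 : ℝ≥0∞) ^ t α) l * liminf (fun α => max c (a α ^ t α)) l :=
        ENNReal.liminf_mul_le (Or.inl (by simp [h1])) (Or.inl (by simp [h1]))
    _ = _ := by
        rw [h1, one_mul, max_comm]
        exact (sup_liminf c).symm

end Powers

lemma exp_div_rpow (c : ℝ) {s : ℝ} (hs : 0 < s) :
    EReal.exp ((c : EReal) / (s : EReal)) ^ s = EReal.exp c := by
  rw [← EReal.exp_mul, ← EReal.coe_div, ← EReal.coe_mul, div_mul_cancel₀ _ hs.ne']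

lemma iInf_pos_le_of_le_two_mul_add {f : ℝ → EReal} {b : EReal}
    (h : ∀ r : ℝ, 0 < r → f r ≤ ((2 * r : ℝ) : EReal) + b) : ⨅ (r : ℝ) (_ : 0 < r), f r ≤ b := by
  refine EReal.le_of_forall_lt_iff_le.1 fun z hz => ?_
  obtain ⟨b', hb, hb'⟩ := EReal.lt_iff_exists_real_btwn.1 hz
  have hb'' : b' < z := EReal.coe_lt_coe_iff.1 hb'
  -- This `r` solves `2r + b' = z`.
  refine (iInf₂_le ((z - b') / 2) (by linarith)).trans ((h _ (by linarith)).trans ?_)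
  refine (add_le_add_right hb.le _).trans ?_
  rw [← EReal.coe_add, EReal.coe_le_coe_iff]
  linarith

lemma le_neg_log_iff {z : EReal} {a : ℝ≥0∞} : z ≤ -ENNReal.log a ↔ a ≤ EReal.exp (-z) := by
  rw [EReal.le_neg, ← EReal.exp_le_exp_iff, ENNReal.exp_log]

lemma lt_neg_log_iff {z : EReal} {a : ℝ≥0∞} : z < -ENNReal.log a ↔ a < EReal.exp (-z) := by
  rw [EReal.lt_neg_comm, ← EReal.exp_lt_exp_iff, ENNReal.exp_log]

lemma neg_log_le_add_neg_log {c : ℝ} {u a : ℝ≥0∞} (h : EReal.exp ((-c : ℝ) : EReal) * u ≤ a) :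
    -ENNReal.log a ≤ (c : EReal) + -ENNReal.log u := by
  have h' := ENNReal.log_le_log h
  rw [ENNReal.log_mul_add, EReal.log_exp] at h'
  refine (EReal.neg_le_neg_iff.2 h').trans_eq ?_
  rw [EReal.neg_add (Or.inl (by simp)) (Or.inl (by simp)), EReal.coe_neg, neg_neg, sub_eq_add_neg]

/-! ### Integral estimates and local limits. -/

section Net

variable {X : Type*} [TopologicalSpace X] [MeasurableSpace X] {ι : Type*} [Preorder ι]
  [IsDirectedOrder ι] [Nonempty ι] {μ : ι → Measure X} {t : ι → ℝ}

lemma limsupMeasure_mono (ht : ∀ α, 0 < t α) {A B : Set X} (h : A ⊆ B) :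
    limsupMeasure μ t A ≤ limsupMeasure μ t B :=
  limsup_le_limsup (Eventually.of_forall fun α =>
    ENNReal.rpow_le_rpow (measure_mono h) (ht α).le)

lemma limsupMeasure_le_one (ht : ∀ α, 0 < t α) (hμ : ∀ α, IsProbabilityMeasure (μ α))
    (A : Set X) : limsupMeasure μ t A ≤ 1 :=
  (limsup_le_limsup (Eventually.of_forall fun α =>
    ENNReal.rpow_le_one prob_le_one (ht α).le)).trans_eq (limsup_const 1)

lemma liminfMeasure_le_limsupMeasure (A : Set X) : liminfMeasure μ t A ≤ limsupMeasure μ t A :=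
  liminf_le_limsup

lemma limsupMeasure_empty (ht : ∀ α, 0 < t α) : limsupMeasure μ t ∅ = 0 := by
  have : powMeasure μ t ∅ = fun _ => 0 := by
    ext α
    simp [powMeasure, ENNReal.zero_rpow_of_pos (ht α)]
  rw [limsupMeasure, this, limsup_const]

lemma limsupMeasure_union_le (ht : ∀ α, 0 < t α) (ht0 : Tendsto t atTop (𝓝 0)) (A B : Set X) :
    limsupMeasure μ t (A ∪ B) ≤ max (limsupMeasure μ t A) (limsupMeasure μ t B) :=
  (limsup_le_limsup (Eventually.of_forall fun α =>
    ENNReal.rpow_le_rpow (measure_union_le A B) (ht α).le)).trans (limsup_add_rpow_le ht ht0 _ _)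

lemma limsupMeasure_biUnion_le (ht : ∀ α, 0 < t α) (ht0 : Tendsto t atTop (𝓝 0)) {κ : Type*}
    {S : Set κ} (hS : S.Finite) (f : κ → Set X) {c : ℝ≥0∞}
    (h : ∀ i ∈ S, limsupMeasure μ t (f i) ≤ c) : limsupMeasure μ t (⋃ i ∈ S, f i) ≤ c := by
  induction S, hS using Set.Finite.induction_on with
  | empty => simp [limsupMeasure_empty ht]
  | insert _ _ ih =>
    rw [biUnion_insert]
    exact (limsupMeasure_union_le ht ht0 _ _).trans (max_le (h _ (mem_insert _ _))
      (ih fun i hi => h i (mem_insert_of_mem _ hi)))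

/-- The integrand is at most `1` on `A` and at most `e^{c/t}` off `A`; the outer power later turns
`e^{c/t}` into the constant `e^c`. -/
lemma powIntegral_le (ht : ∀ α, 0 < t α) (hμ : ∀ α, IsProbabilityMeasure (μ α)) {h : X → EReal}
    (h0 : ∀ x, h x ≤ 0) {A : Set X} (hA : MeasurableSet A) {c : ℝ} (hc : ∀ x ∉ A, h x ≤ c)
    (α : ι) :
    powIntegral μ t h α ≤ (μ α A + EReal.exp ((c : EReal) / ((t α : ℝ) : EReal))) ^ t α := by
  have htα : (0 : EReal) ≤ ((t α : ℝ) : EReal) := by exact_mod_cast (ht α).le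
  refine ENNReal.rpow_le_rpow ?_ (ht α).le
  calc ∫⁻ x, EReal.exp (h x / ((t α : ℝ) : EReal)) ∂(μ α)
      ≤ ∫⁻ x, (A.indicator 1 x + EReal.exp ((c : EReal) / ((t α : ℝ) : EReal))) ∂(μ α) := by
        refine lintegral_mono fun x => ?_
        by_cases hx : x ∈ A
        · refine le_add_right ?_
          rw [indicator_of_mem hx, Pi.one_apply, EReal.exp_le_one_iff]
          exact EReal.div_nonpos_of_nonpos_of_nonneg (h0 x) htα
        · refine le_add_left (EReal.exp_monotone ?_)
          exact EReal.div_le_div_right_of_nonneg htα (hc x hx)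
    _ = _ := by
        have := hμ α
        rw [lintegral_add_right _ measurable_const, lintegral_indicator_one hA, lintegral_const,
          measure_univ, mul_one]

lemma limsup_powIntegral_le (ht : ∀ α, 0 < t α) (ht0 : Tendsto t atTop (𝓝 0))
    (hμ : ∀ α, IsProbabilityMeasure (μ α)) {h : X → EReal} (h0 : ∀ x, h x ≤ 0) {A : Set X}
    (hA : MeasurableSet A) {c : ℝ} (hc : ∀ x ∉ A, h x ≤ c) :
    limsup (powIntegral μ t h) atTop ≤ max (limsupMeasure μ t A) (EReal.exp c) := by
  refine (limsup_le_limsup (Eventually.of_forall (powIntegral_le ht hμ h0 hA hc))).trans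
    ((limsup_add_rpow_le ht ht0 _ _).trans_eq ?_)
  simp_rw [exp_div_rpow c (ht _), limsup_const]
  rfl

lemma liminf_powIntegral_le (ht : ∀ α, 0 < t α) (ht0 : Tendsto t atTop (𝓝 0))
    (hμ : ∀ α, IsProbabilityMeasure (μ α)) {h : X → EReal} (h0 : ∀ x, h x ≤ 0) {A : Set X}
    (hA : MeasurableSet A) {c : ℝ} (hc : ∀ x ∉ A, h x ≤ c) :
    liminf (powIntegral μ t h) atTop ≤ max (liminfMeasure μ t A) (EReal.exp c) :=
  (liminf_le_liminf (Eventually.of_forall (powIntegral_le ht hμ h0 hA hc))).trans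
    (liminf_add_rpow_le ht ht0 _ _ _ fun α => exp_div_rpow c (ht α))

/-- Chebyshev's inequality. -/
lemma exp_mul_powMeasure_le (ht : ∀ α, 0 < t α) {h : X → EReal} {A : Set X}
    (hA : MeasurableSet A) {c : ℝ} (hc : ∀ x ∈ A, c ≤ h x) (α : ι) :
    EReal.exp c * powMeasure μ t A α ≤ powIntegral μ t h α := by
  have htα : (0 : EReal) ≤ ((t α : ℝ) : EReal) := by exact_mod_cast (ht α).le
  rw [← exp_div_rpow c (ht α), powMeasure, ← ENNReal.mul_rpow_of_nonneg _ _ (ht α).le]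
  refine ENNReal.rpow_le_rpow ?_ (ht α).le
  rw [← lintegral_indicator_const hA]
  refine lintegral_mono fun x => ?_
  refine indicator_apply_le' (fun hx => ?_) fun _ => zero_le
  exact EReal.exp_monotone (EReal.div_le_div_right_of_nonneg htα (hc x hx))

lemma exp_mul_limsupMeasure_le (ht : ∀ α, 0 < t α) {h : X → EReal} {A : Set X}
    (hA : MeasurableSet A) {c : ℝ} (hc : ∀ x ∈ A, c ≤ h x) :
    EReal.exp c * limsupMeasure μ t A ≤ limsup (powIntegral μ t h) atTop := by
  rw [limsupMeasure, ← ENNReal.limsup_const_mul_of_ne_top (by simp)]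
  exact limsup_le_limsup (Eventually.of_forall (exp_mul_powMeasure_le ht hA hc))

lemma exp_mul_liminfMeasure_le (ht : ∀ α, 0 < t α) {h : X → EReal} {A : Set X}
    (hA : MeasurableSet A) {c : ℝ} (hc : ∀ x ∈ A, c ≤ h x) :
    EReal.exp c * liminfMeasure μ t A ≤ liminf (powIntegral μ t h) atTop := by
  rw [liminfMeasure, ← ENNReal.liminf_const_mul_of_ne_top (by simp)]
  exact liminf_le_liminf (Eventually.of_forall (exp_mul_powMeasure_le ht hA hc))

/-- The local lower limit `-log inf {liminf μ_α^{t_α}(G) : G open, x ∈ G}`. -/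
noncomputable def lOne (μ : ι → Measure X) (t : ι → ℝ) (x : X) : EReal :=
  -ENNReal.log (⨅ (G : Set X) (_ : IsOpen G) (_ : x ∈ G), liminfMeasure μ t G)

lemma lZero_le_lOne (x : X) : lZero μ t x ≤ lOne μ t x :=
  EReal.neg_le_neg_iff.2 (ENNReal.log_le_log (iInf_mono fun _ => iInf_mono fun _ =>
    iInf_mono fun _ => liminfMeasure_le_limsupMeasure _))

lemma lt_lZero_iff {x : X} {z : EReal} :
    z < lZero μ t x ↔ ∃ G, IsOpen G ∧ x ∈ G ∧ limsupMeasure μ t G < EReal.exp (-z) := by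
  simp only [lZero, lt_neg_log_iff, iInf_lt_iff, exists_prop]

lemma lt_lOne_iff {x : X} {z : EReal} :
    z < lOne μ t x ↔ ∃ G, IsOpen G ∧ x ∈ G ∧ liminfMeasure μ t G < EReal.exp (-z) := by
  simp only [lOne, lt_neg_log_iff, iInf_lt_iff, exists_prop]

lemma exp_neg_lZero_le {x : X} {G : Set X} (hG : IsOpen G) (hx : x ∈ G) :
    EReal.exp (-lZero μ t x) ≤ limsupMeasure μ t G := by
  rw [lZero, neg_neg, ENNReal.exp_log]
  exact iInf_le_of_le G (iInf₂_le hG hx)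

lemma exp_neg_lOne_le {x : X} {G : Set X} (hG : IsOpen G) (hx : x ∈ G) :
    EReal.exp (-lOne μ t x) ≤ liminfMeasure μ t G := by
  rw [lOne, neg_neg, ENNReal.exp_log]
  exact iInf_le_of_le G (iInf₂_le hG hx)

lemma lZero_nonneg (ht : ∀ α, 0 < t α) (hμ : ∀ α, IsProbabilityMeasure (μ α)) (x : X) :
    0 ≤ lZero μ t x := by
  rw [← EReal.neg_le_zero, ← EReal.exp_le_one_iff]
  exact (exp_neg_lZero_le isOpen_univ (mem_univ x)).trans (limsupMeasure_le_one ht hμ _)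

lemma neg_LambdaUpper_le [BorelSpace X] (ht : ∀ α, 0 < t α) {h : X → EReal} (hh : Continuous h)
    {x : X} {r : ℝ} (hr : 0 < r) (hx : ((-r : ℝ) : EReal) ≤ h x) :
    -LambdaUpper μ t h ≤ ((2 * r : ℝ) : EReal) + lZero μ t x := by
  have hG : IsOpen {y | ((-(2 * r) : ℝ) : EReal) < h y} := isOpen_lt continuous_const hh
  refine neg_log_le_add_neg_log ((mul_le_mul_right ?_ _).trans
    (exp_mul_limsupMeasure_le ht hG.measurableSet fun y hy => le_of_lt hy))
  refine iInf_le_of_le _ (iInf₂_le hG (lt_of_lt_of_le ?_ hx))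
  exact EReal.coe_lt_coe_iff.2 (by linarith)

lemma exists_neg_LambdaLower_trunc_le [BorelSpace X] (ht : ∀ α, 0 < t α) {h : X → EReal}
    (hh : Continuous h) {x : X} (htop : h x ≠ ⊤) {r : ℝ} (hr : 0 < r)
    (hx : ((-r : ℝ) : EReal) ≤ h x) :
    ∃ M : ℝ, -LambdaLower μ t (trunc h M) ≤ ((2 * r : ℝ) : EReal) + lOne μ t x := by
  obtain ⟨M, hM, -⟩ := EReal.lt_iff_exists_real_btwn.1 (lt_top_iff_ne_top.2 htop)
  -- Since `M > h x`, this is a neighbourhood of `x` on which truncation changes nothing.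
  have hG : IsOpen {y | ((-(2 * r) : ℝ) : EReal) < h y ∧ h y < M} :=
    (isOpen_lt continuous_const hh).inter (isOpen_lt hh continuous_const)
  refine ⟨M, neg_log_le_add_neg_log ((mul_le_mul_right ?_ _).trans
    (exp_mul_liminfMeasure_le ht hG.measurableSet fun y hy => ?_))⟩
  · refine iInf_le_of_le _ (iInf₂_le hG ⟨lt_of_lt_of_le ?_ hx, hM⟩)
    exact EReal.coe_lt_coe_iff.2 (by linarith)
  · rw [trunc, if_pos hy.2]
    exact hy.1.le

lemma powIntegral_mono (ht : ∀ α, 0 < t α) {g h : X → EReal} (hgh : ∀ x, g x ≤ h x) (α : ι) :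
    powIntegral μ t g α ≤ powIntegral μ t h α :=
  ENNReal.rpow_le_rpow (lintegral_mono fun x => EReal.exp_monotone
    (EReal.div_le_div_right_of_nonneg (by exact_mod_cast (ht α).le) (hgh x))) (ht α).le

lemma trunc_mono (h : X → EReal) {M N : ℝ} (hMN : M ≤ N) (x : X) : trunc h M x ≤ trunc h N x := by
  by_cases hx : h x < M
  · rw [trunc, if_pos hx, trunc, if_pos (hx.trans_le (EReal.coe_le_coe_iff.2 hMN))]
  · rw [trunc, if_neg hx]
    exact bot_le

lemma antitone_neg_LambdaLower_trunc (ht : ∀ α, 0 < t α) (h : X → EReal) :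
    Antitone fun M : ℝ => -LambdaLower μ t (trunc h M) := fun _ _ hMN =>
  EReal.neg_le_neg_iff.2 (ENNReal.log_le_log (liminf_le_liminf (Eventually.of_forall
    (powIntegral_mono ht (trunc_mono h hMN)))))

end Net

/-! ### Separating functions and regularity at points of `X₀`. -/

section Separation

variable {X : Type*}

lemma Separates.nonpos {h : X → EReal} {x : X} {G : Set X} {s r : ℝ} (hs : 0 < s)
    (hh : Separates h x G s r) (y : X) : h y ≤ 0 := by
  rw [← EReal.exp_le_one_iff]
  refine (hh y).2.trans (max_le (indicator_le_self' (fun _ _ => zero_le) y) ?_)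
  rw [EReal.exp_le_one_iff]
  exact EReal.coe_nonpos.2 (by linarith)

lemma Separates.le_apply {h : X → EReal} {x : X} {G : Set X} {s r : ℝ}
    (hh : Separates h x G s r) : ((-r : ℝ) : EReal) ≤ h x := by
  simpa only [indicator_of_mem (mem_singleton x), EReal.exp_le_exp_iff] using (hh x).1

lemma le_of_notMem_of_exp_le {a : EReal} {y : X} {G : Set X} {s : ℝ}
    (h : EReal.exp a ≤ max (G.indicator (fun _ => (1 : ℝ≥0∞)) y) (EReal.exp ((-s : ℝ) : EReal)))
    (hy : y ∉ G) : a ≤ ((-s : ℝ) : EReal) := by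
  rw [indicator_of_notMem hy, max_eq_right zero_le] at h
  exact EReal.exp_le_exp_iff.1 h

lemma negPart_negPart (T : Set (X → EReal)) : negPart (negPart T) = negPart T := by
  ext h
  exact ⟨fun hh => hh.1, fun hh => ⟨hh, hh.2⟩⟩

variable [TopologicalSpace X]

lemma IsApproximatingClass.negPart {T : Set (X → EReal)} (hT : IsApproximatingClass T) :
    IsApproximatingClass (negPart T) where
  continuous h hh := hT.continuous h hh.1
  ne_top h hh := hT.ne_top h hh.1
  approx x hx G hG hxG s hs r hr :=
    let ⟨h, hh, hsep⟩ := hT.approx x hx G hG hxG s hs r hr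
    ⟨h, ⟨hh, hsep.nonpos hs⟩, hsep⟩

lemma exists_open_closure_subset_of_mem_regPart {x : X} (hx : x ∈ regPart X) {G : Set X}
    (hG : IsOpen G) (hxG : x ∈ G) : ∃ V, IsOpen V ∧ x ∈ V ∧ closure V ⊆ G := by
  -- The level `-2` lies strictly between `h x ≥ -1` and `h ≤ -3` off `G`.
  obtain ⟨h, hh⟩ := hx G hG hxG 3 (by norm_num) 1 one_pos
  have hx1 : -1 ≤ h x := EReal.coe_le_coe_iff.1 hh.le_apply
  refine ⟨{y | -2 < h y}, isOpen_lt continuous_const h.continuous, ?_, ?_⟩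
  · exact lt_of_lt_of_le (by norm_num) hx1
  · refine (closure_lt_subset_le continuous_const h.continuous).trans fun y hy => ?_
    by_contra hyG
    have h1 : h y ≤ -3 := EReal.coe_le_coe_iff.1 (le_of_notMem_of_exp_le (hh y).2 hyG)
    have h2 : -2 ≤ h y := hy
    linarith

end Separation

/-! ### Tightness and the cover condition. -/

section Cover

variable {X : Type*} [TopologicalSpace X] [MeasurableSpace X] {ι : Type*} [Preorder ι]
  [IsDirectedOrder ι] [Nonempty ι] {μ : ι → Measure X} {t : ι → ℝ}

/-- The hypothesis `hK` is common to both kinds of tightness: its last clause is vacuous when `K ⊆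
X₀`. -/
lemma coverCondition_of_expTight (ht : ∀ α, 0 < t α) (ht0 : Tendsto t atTop (𝓝 0))
    (hμ : ∀ α, IsProbabilityMeasure (μ α))
    (hK : ∀ ε : ℝ≥0∞, 0 < ε → ∃ K : Set X, IsCompact K ∧ limsupMeasure μ t Kᶜ < ε ∧
      ∀ x ∈ K, x ∉ regPart X → lZero μ t x = ⊤) :
    CoverCondition μ t := by
  intro F hF 𝒢 h𝒢 hcov ε hε
  obtain ⟨K, hKc, hKε, hKX⟩ := hK ε hε
  obtain ⟨δ, hδ, hδε⟩ := exists_between hε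
  -- The added negligible open sets cover the points of `K` outside `X₀`. After extracting a finite
  -- subcover, those not in `𝒢` join `Kᶜ` in a remainder of size `< ε`.
  let 𝒱 : Set (Set X) := 𝒢 ∪ {G | IsOpen G ∧ limsupMeasure μ t G < δ}
  have hcov' : F ∩ K ⊆ ⋃ G ∈ 𝒱, id G := by
    simp only [id, ← sUnion_eq_biUnion]
    rintro x ⟨hxF, hxK⟩
    by_cases hx : x ∈ regPart X
    · exact sUnion_mono subset_union_left (hcov ⟨hxF, hx⟩)
    · have h1 : -ENNReal.log δ < lZero μ t x := by
        rw [hKX x hxK hx, lt_top_iff_ne_top, Ne, EReal.neg_eq_top_iff, ENNReal.log_eq_bot_iff]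
        exact hδ.ne'
      obtain ⟨G, hG, hxG, hGδ⟩ := lt_lZero_iff.1 h1
      rw [neg_neg, ENNReal.exp_log] at hGδ
      exact ⟨G, Or.inr ⟨hG, hGδ⟩, hxG⟩
  obtain ⟨𝒮, h𝒮, h𝒮f, h𝒮c⟩ := (hKc.inter_left hF).elim_finite_subcover_image
    (c := id) (fun G hG => hG.elim (h𝒢 G) And.left) hcov'
  refine ⟨𝒮 ∩ 𝒢, inter_subset_right, h𝒮f.subset inter_subset_left, ?_⟩
  set U := ⋃ G ∈ 𝒮 ∩ 𝒢, closure G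
  set B := ⋃ G ∈ 𝒮 \ 𝒢, G
  have hB : limsupMeasure μ t B ≤ δ :=
    limsupMeasure_biUnion_le ht ht0 (h𝒮f.subset sdiff_subset) id fun G hG =>
      ((h𝒮 hG.1).resolve_left hG.2).2.le
  have hFsub : F ⊆ U ∪ (B ∪ Kᶜ) := by
    intro x hx
    by_cases hxK : x ∈ K
    · obtain ⟨G, hG, hxG⟩ := mem_iUnion₂.1 (h𝒮c ⟨hx, hxK⟩)
      by_cases hG' : G ∈ 𝒢
      · exact Or.inl (mem_biUnion (show G ∈ 𝒮 ∩ 𝒢 from ⟨hG, hG'⟩) (subset_closure hxG))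
      · exact Or.inr (Or.inl (mem_biUnion (show G ∈ 𝒮 \ 𝒢 from ⟨hG, hG'⟩) hxG))
    · exact Or.inr (Or.inr hxK)
  have hUtop : limsupMeasure μ t U ≠ ⊤ :=
    ((limsupMeasure_le_one ht hμ U).trans_lt ENNReal.one_lt_top).ne
  refine (limsupMeasure_mono ht hFsub).trans_lt ((limsupMeasure_union_le ht ht0 _ _).trans_lt
    (max_lt (ENNReal.lt_add_right hUtop hε.ne') ?_))
  exact ((limsupMeasure_union_le ht ht0 _ _).trans_lt
    (max_lt (hB.trans_lt hδε) hKε)).trans_le le_add_self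

lemma lZero_eq_top_of_regExpTight (hKF : ∀ K : Set X, IsCompact K → IsClosed K)
    (h : RegExpTight μ t) {x : X} (hx : x ∉ regPart X) : lZero μ t x = ⊤ := by
  rw [EReal.eq_top_iff_forall_lt]
  intro z
  -- The complement of `K` is itself the required open neighbourhood of `x`.
  obtain ⟨K, hK, hKX, hKε⟩ := h (EReal.exp (-(z : EReal)))
    (by simp [← EReal.coe_neg, EReal.bot_lt_coe, -EReal.exp_coe])
  exact lt_lZero_iff.2 ⟨Kᶜ, (hKF K hK).isOpen_compl, fun hxK => hx (hKX hxK), hKε⟩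

/-! ### The candidate rate function, its regularization and the upper bounds. -/

open Classical in
/-- The function equal to `l₀` on `X₀` and to `+∞` elsewhere. -/
noncomputable def lReg (μ : ι → Measure X) (t : ι → ℝ) (x : X) : EReal :=
  if x ∈ regPart X then lZero μ t x else ⊤

/-- The lower regularization `sup_{G ∋ x} inf_{G ∩ X₀} l₀` of `lReg`. -/
noncomputable def lRate (μ : ι → Measure X) (t : ι → ℝ) (x : X) : EReal :=
  ⨆ (G : Set X) (_ : IsOpen G) (_ : x ∈ G), ⨅ y ∈ G ∩ regPart X, lZero μ t y

lemma lReg_of_mem {x : X} (hx : x ∈ regPart X) : lReg μ t x = lZero μ t x := if_pos hx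

lemma lReg_of_notMem {x : X} (hx : x ∉ regPart X) : lReg μ t x = ⊤ := if_neg hx

lemma lt_lRate_iff {x : X} {z : EReal} :
    z < lRate μ t x ↔ ∃ G, IsOpen G ∧ x ∈ G ∧ z < ⨅ y ∈ G ∩ regPart X, lZero μ t y := by
  simp only [lRate, lt_iSup_iff, exists_prop]

/-- `lZero` is already lower semicontinuous: a `G` witnessing `z < lZero x` witnesses it at every
point of `G`. -/
lemma lRate_eq_lZero {x : X} (hx : x ∈ regPart X) : lRate μ t x = lZero μ t x := by
  refine le_antisymm (iSup_le fun G => iSup₂_le fun hG hxG => iInf₂_le x ⟨hxG, hx⟩) ?_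
  refine le_of_forall_lt fun z hz => ?_
  obtain ⟨z', hz, hz'⟩ := exists_between hz
  obtain ⟨G, hG, hxG, hlt⟩ := lt_lZero_iff.1 hz'
  exact lt_lRate_iff.2 ⟨G, hG, hxG, hz.trans_le (le_iInf₂ fun y hy =>
    (lt_lZero_iff.2 ⟨G, hG, hy.1, hlt⟩).le)⟩

lemma isGreatest_lRate :
    IsGreatest {g : X → EReal | LowerSemicontinuous g ∧ ∀ x, g x ≤ lReg μ t x} (lRate μ t) := by
  refine ⟨⟨fun x z hz => ?_, fun x => ?_⟩, ?_⟩
  · obtain ⟨G, hG, hxG, hlt⟩ := lt_lRate_iff.1 hz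
    filter_upwards [hG.mem_nhds hxG] with y hy using lt_lRate_iff.2 ⟨G, hG, hy, hlt⟩
  · by_cases hx : x ∈ regPart X
    · rw [lReg_of_mem hx, lRate_eq_lZero hx]
    · rw [lReg_of_notMem hx]
      exact le_top
  · rintro g ⟨hg, hgl⟩ x
    refine le_of_forall_lt fun z hz => ?_
    obtain ⟨z', hz, hz'⟩ := exists_between hz
    refine lt_lRate_iff.2 ⟨g ⁻¹' Ioi z', hg.isOpen_preimage z', hz', hz.trans_le
      (le_iInf₂ fun y hy => ?_)⟩
    exact (le_of_lt hy.1).trans ((hgl y).trans_eq (lReg_of_mem hy.2))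

lemma upperBounds_lReg (ht : ∀ α, 0 < t α) (ht0 : Tendsto t atTop (𝓝 0))
    (hcov : CoverCondition μ t) : UpperBounds μ t (lReg μ t) := by
  intro F hF
  set S := ⨆ x ∈ F, EReal.exp (-(lReg μ t x))
  refine ENNReal.le_of_forall_pos_le_add fun ε hε hS => ?_
  -- One half pays for the choice of neighbourhoods, the other for the cover condition.
  have hε2 : (0 : ℝ≥0∞) < (ε : ℝ≥0∞) / 2 := ENNReal.half_pos (by exact_mod_cast hε.ne')
  have hcover : F ∩ regPart X ⊆
      ⋃₀ {V | IsOpen V ∧ limsupMeasure μ t (closure V) ≤ S + (ε : ℝ≥0∞) / 2} := by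
    rintro x ⟨hxF, hx⟩
    have h1 : EReal.exp (-lZero μ t x) ≤ S := by
      rw [← lReg_of_mem hx]
      exact le_iSup₂ (f := fun x _ => EReal.exp (-(lReg μ t x))) x hxF
    have h2 := h1.trans_lt (ENNReal.lt_add_right hS.ne hε2.ne')
    rw [lZero, neg_neg, ENNReal.exp_log] at h2
    simp only [iInf_lt_iff] at h2
    obtain ⟨G, hG, hxG, hlt⟩ := h2
    obtain ⟨V, hV, hxV, hVG⟩ := exists_open_closure_subset_of_mem_regPart hx hG hxG
    exact ⟨V, ⟨hV, (limsupMeasure_mono ht hVG).trans hlt.le⟩, hxV⟩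
  obtain ⟨𝒮, h𝒮, h𝒮f, hlt⟩ := hcov F hF _ (fun V hV => hV.1) hcover _ hε2
  calc limsupMeasure μ t F
      ≤ limsupMeasure μ t (⋃ G ∈ 𝒮, closure G) + (ε : ℝ≥0∞) / 2 := hlt.le
    _ ≤ S + (ε : ℝ≥0∞) / 2 + (ε : ℝ≥0∞) / 2 :=
        add_le_add_left (limsupMeasure_biUnion_le ht ht0 h𝒮f _ fun V hV => (h𝒮 hV).2) _
    _ = S + ε := by rw [add_assoc, ENNReal.add_halves]

end Cover

/-! ### Approximating classes: identification of `lClass` and the lower bounds. -/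

section Class

variable {X : Type*} [TopologicalSpace X] [MeasurableSpace X] [BorelSpace X] {ι : Type*}
  [Preorder ι] [IsDirectedOrder ι] [Nonempty ι] {μ : ι → Measure X} {t : ι → ℝ}
  {T : Set (X → EReal)}

lemma LambdaExists.lambda_eq_upper {h : X → EReal} (hh : LambdaExists μ t h) :
    Lambda μ t h = LambdaUpper μ t h := by
  obtain ⟨c, hc⟩ := hh
  rw [Lambda, LambdaUpper, hc.limUnder_eq, hc.limsup_eq]

lemma LambdaExists.lower_eq_upper {h : X → EReal} (hh : LambdaExists μ t h) :
    LambdaLower μ t h = LambdaUpper μ t h := by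
  obtain ⟨c, hc⟩ := hh
  rw [LambdaLower, LambdaUpper, hc.liminf_eq, hc.limsup_eq]

lemma tailCondition_of_nonpos (ht : ∀ α, 0 < t α) {h : X → EReal} (h0 : ∀ x, h x ≤ 0) :
    TailCondition μ t h := by
  refine tendsto_const_nhds.congr' ?_
  filter_upwards [eventually_gt_atTop 1] with M hM
  have hempty : {y | ENNReal.ofReal M ≤ EReal.exp (h y)} = (∅ : Set X) := by
    refine eq_empty_of_forall_notMem fun y hy => ?_
    have h1 : ENNReal.ofReal M ≤ 1 := le_trans hy (EReal.exp_le_one_iff.2 (h0 y))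
    exact absurd h1 (not_le.2 (by simpa using hM))
  simp [hempty, ENNReal.zero_rpow_of_pos (ht _)]

lemma trunc_of_nonpos {h : X → EReal} (h0 : ∀ x, h x ≤ 0) {M : ℝ} (hM : 0 < M) :
    trunc h M = h :=
  funext fun x => if_pos ((h0 x).trans_lt (EReal.coe_pos.2 hM))

lemma lOne_le_iSup (ht : ∀ α, 0 < t α) (ht0 : Tendsto t atTop (𝓝 0))
    (hμ : ∀ α, IsProbabilityMeasure (μ α)) (hT : IsApproximatingClass T)
    (hΛ : ∀ h ∈ negPart T, LambdaExists μ t h) {x : X} (hx : x ∈ regPart X) {r : ℝ}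
    (hr : 0 < r) :
    lOne μ t x ≤ ⨆ h ∈ {h ∈ negPart T | ((-r : ℝ) : EReal) ≤ h x}, -Lambda μ t h := by
  refine EReal.ge_of_forall_gt_iff_ge.1 fun z hz => ?_
  obtain ⟨G, hG, hxG, hlt⟩ := lt_lOne_iff.1 hz
  -- The depth must be positive and at least `z`, so that `e^{-s} ≤ e^{-z}`.
  obtain ⟨h, hh, hsep⟩ := hT.negPart.approx x hx G hG hxG (max z 1) (by simp) r hr
  refine le_trans ?_ (le_iSup₂ (f := fun h _ => -Lambda μ t h) h ⟨hh, hsep.le_apply⟩)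
  rw [(hΛ h hh).lambda_eq_upper, ← (hΛ h hh).lower_eq_upper, LambdaLower, le_neg_log_iff]
  refine (liminf_powIntegral_le ht ht0 hμ hh.2 hG.measurableSet fun y hy =>
    le_of_notMem_of_exp_le (hsep y).2 hy).trans (max_le hlt.le (EReal.exp_monotone ?_))
  rw [← EReal.coe_neg, EReal.coe_le_coe_iff]
  exact neg_le_neg (le_max_left _ _)

/-- The chain `lOne ≤ inf sup ≤ lZero ≤ lOne` collapses. -/
lemma iInf_lambda_eq (ht : ∀ α, 0 < t α) (ht0 : Tendsto t atTop (𝓝 0))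
    (hμ : ∀ α, IsProbabilityMeasure (μ α)) (hT : IsApproximatingClass T)
    (hΛ : ∀ h ∈ negPart T, LambdaExists μ t h) {x : X} (hx : x ∈ regPart X) :
    lOne μ t x = lZero μ t x ∧
    (⨅ (r : ℝ) (_ : 0 < r), ⨆ h ∈ {h ∈ negPart T | ((-r : ℝ) : EReal) ≤ h x}, -Lambda μ t h) =
      lZero μ t x := by
  have h1 : lOne μ t x ≤ ⨅ (r : ℝ) (_ : 0 < r),
      ⨆ h ∈ {h ∈ negPart T | ((-r : ℝ) : EReal) ≤ h x}, -Lambda μ t h :=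
    le_iInf₂ fun r hr => lOne_le_iSup ht ht0 hμ hT hΛ hx hr
  have h2 : (⨅ (r : ℝ) (_ : 0 < r),
      ⨆ h ∈ {h ∈ negPart T | ((-r : ℝ) : EReal) ≤ h x}, -Lambda μ t h) ≤ lZero μ t x :=
    iInf_pos_le_of_le_two_mul_add fun r hr => iSup₂_le fun h hh => by
      rw [(hΛ h hh.1).lambda_eq_upper]
      exact neg_LambdaUpper_le ht (hT.continuous h hh.1.1) hr hh.2
  exact ⟨(h1.trans h2).antisymm (lZero_le_lOne x), h2.antisymm ((lZero_le_lOne x).trans h1)⟩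

lemma lClass_eq_lZero (ht : ∀ α, 0 < t α) (ht0 : Tendsto t atTop (𝓝 0))
    (hμ : ∀ α, IsProbabilityMeasure (μ α)) (hT : IsApproximatingClass T)
    (hΛ : ∀ h ∈ negPart T, LambdaExists μ t h) {x : X} (hx : x ∈ regPart X) :
    lClass μ t T x = lZero μ t x := by
  rw [lClass, if_pos hx]
  refine le_antisymm ?_ ?_
  · exact iInf_pos_le_of_le_two_mul_add fun r hr => iSup₂_le fun h hh =>
      neg_LambdaUpper_le ht (hT.continuous h hh.1.1) hr hh.2
  · rw [← (iInf_lambda_eq ht ht0 hμ hT hΛ hx).2]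
    refine iInf₂_mono fun r hr => iSup₂_le fun h hh => ?_
    rw [(hΛ h hh.1).lambda_eq_upper]
    exact le_iSup₂ (f := fun h _ => -LambdaUpper μ t h) h
      ⟨⟨hh.1.1, tailCondition_of_nonpos ht hh.1.2⟩, hh.2⟩

/-- The infimum over `M` is the limit, by antitonicity. Lower limits of integrals are controlled by
`lOne`, hence the need for `lOne = lZero`. -/
lemma iInf_trunc_eq_lZero (ht : ∀ α, 0 < t α) (ht0 : Tendsto t atTop (𝓝 0))
    (hμ : ∀ α, IsProbabilityMeasure (μ α)) (hT : IsApproximatingClass T)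
    (hΛ : ∀ h ∈ negPart T, LambdaExists μ t h) {x : X} (hx : x ∈ regPart X) :
    (⨅ (r : ℝ) (_ : 0 < r), ⨆ h ∈ {h ∈ T | ((-r : ℝ) : EReal) ≤ h x},
      ⨅ M : ℝ, -LambdaLower μ t (trunc h M)) = lZero μ t x := by
  obtain ⟨h1, h2⟩ := iInf_lambda_eq ht ht0 hμ hT hΛ hx
  refine le_antisymm ?_ ?_
  · rw [← h1]
    refine iInf_pos_le_of_le_two_mul_add fun r hr => iSup₂_le fun h hh => ?_
    obtain ⟨M, hM⟩ := exists_neg_LambdaLower_trunc_le (μ := μ) ht (hT.continuous h hh.1)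
      (hT.ne_top h hh.1 x) hr hh.2
    exact (iInf_le _ M).trans hM
  · rw [← h2]
    refine iInf₂_mono fun r hr => iSup₂_le fun h hh => le_trans (le_iInf fun M => ?_)
      (le_iSup₂ (f := fun h _ => ⨅ M : ℝ, -LambdaLower μ t (trunc h M)) h ⟨hh.1.1, hh.2⟩)
    -- Truncating at the positive level `max M 1` leaves `h ≤ 0` unchanged, and raising the level
    -- from `M` can only decrease the value.
    rw [(hΛ h hh.1).lambda_eq_upper, ← (hΛ h hh.1).lower_eq_upper,
      ← trunc_of_nonpos hh.1.2 (lt_max_of_lt_right one_pos : (0 : ℝ) < max M 1)]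
    refine (antitone_neg_LambdaLower_trunc ht _ (le_max_left M 1)).trans ?_
    rw [trunc_of_nonpos hh.1.2 (lt_max_of_lt_right one_pos : (0 : ℝ) < max M 1)]

lemma lClass_eq_lRate (ht : ∀ α, 0 < t α) (ht0 : Tendsto t atTop (𝓝 0))
    (hμ : ∀ α, IsProbabilityMeasure (μ α)) (hT : IsApproximatingClass T)
    (hcov : CoverCondition μ t) (hΛ : ∀ h ∈ negPart T, LambdaExists μ t h) :
    lClass μ t T = lRate μ t := by
  ext x
  by_cases hx : x ∈ regPart X
  · rw [lClass_eq_lZero ht ht0 hμ hT hΛ hx, lRate_eq_lZero hx]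
  rw [lClass, if_neg hx]
  refine le_antisymm ?_ ?_
  · refine iSup_mono fun G => iSup_mono fun hG => iSup_mono fun hxG => iSup₂_le fun s hs =>
      le_iInf₂ fun y hy => ?_
    -- The inner infimum does not depend on `r`; the dummy index lets the error `2r` be sent to `0`.
    have key : (⨅ (r : ℝ) (_ : 0 < r), ⨅ h ∈ classAt T G s, -LambdaUpper μ t h) ≤
        lZero μ t y := iInf_pos_le_of_le_two_mul_add fun r hr => by
      obtain ⟨h, hh, hsep⟩ := hT.approx y hy.2 G hG hy.1 s hs r hr
      exact (iInf₂_le h ⟨y, hy, r, hr, hh, fun z => (hsep z).2, hsep.le_apply⟩).trans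
        (neg_LambdaUpper_le ht (hT.continuous h hh) hr hsep.le_apply)
    exact (le_iInf₂ fun _ _ => le_rfl).trans key
  · refine EReal.ge_of_forall_gt_iff_ge.1 fun z hz => ?_
    obtain ⟨G, hG, hxG, hlt⟩ := lt_lRate_iff.1 hz
    -- With this `s`, every `h` of the class is below `-max z 0` off `G`, so the closed superlevel
    -- set at that height lies in `G` and the upper bounds apply to it.
    have hs : 0 < max z 0 + 1 := by positivity
    refine le_trans (le_iInf₂ fun h hh => ?_) (le_iSup_of_le G (le_iSup_of_le hG
      (le_iSup_of_le hxG (le_iSup₂ (f := fun s _ => ⨅ h ∈ classAt T G s, -LambdaUpper μ t h)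
        (max z 0 + 1) hs))))
    obtain ⟨y, -, r, -, hhT, hle, -⟩ := hh
    have hcont := hT.continuous h hhT
    have h0 : ∀ y, h y ≤ 0 := fun y => by
      rw [← EReal.exp_le_one_iff]
      refine (hle y).trans (max_le (indicator_le_self' (fun _ _ => zero_le) y) ?_)
      rw [EReal.exp_le_one_iff]
      exact EReal.coe_nonpos.2 (by linarith)
    have hF : IsClosed {y | ((-(max z 0) : ℝ) : EReal) ≤ h y} :=
      isClosed_le continuous_const hcont
    rw [LambdaUpper, le_neg_log_iff]
    refine (limsup_powIntegral_le ht ht0 hμ h0 hF.measurableSet fun y hy =>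
      (not_le.1 hy).le).trans (max_le ?_ (EReal.exp_monotone ?_))
    · refine (upperBounds_lReg ht ht0 hcov _ hF).trans (iSup₂_le fun y hy =>
        EReal.exp_monotone (EReal.neg_le_neg_iff.2 ?_))
      have hyG : y ∈ G := by
        by_contra hyG
        have h1 := le_trans hy (le_of_notMem_of_exp_le (hle y) hyG)
        rw [EReal.coe_le_coe_iff] at h1
        linarith
      by_cases hyX : y ∈ regPart X
      · rw [lReg_of_mem hyX]
        exact hlt.le.trans (iInf₂_le y ⟨hyG, hyX⟩)
      · rw [lReg_of_notMem hyX]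
        exact le_top
    · rw [← EReal.coe_neg, EReal.coe_le_coe_iff]
      exact neg_le_neg (le_max_left _ _)

lemma lowerBounds_lReg (ht : ∀ α, 0 < t α) (ht0 : Tendsto t atTop (𝓝 0))
    (hμ : ∀ α, IsProbabilityMeasure (μ α)) (hT : IsApproximatingClass T)
    (hΛ : ∀ h ∈ negPart T, LambdaExists μ t h) : LowerBounds μ t (lReg μ t) := by
  refine fun G hG => iSup₂_le fun x hxG => ?_
  by_cases hx : x ∈ regPart X
  · rw [lReg_of_mem hx, ← (iInf_lambda_eq ht ht0 hμ hT hΛ hx).1]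
    exact exp_neg_lOne_le hG hxG
  · simp [lReg_of_notMem hx]

lemma isLDPWithRate_lRate (ht : ∀ α, 0 < t α) (ht0 : Tendsto t atTop (𝓝 0))
    (hμ : ∀ α, IsProbabilityMeasure (μ α)) (hT : IsApproximatingClass T)
    (hcov : CoverCondition μ t) (hΛ : ∀ h ∈ negPart T, LambdaExists μ t h) :
    IsLDPWithRate μ t (lRate μ t) := by
  refine ⟨lReg μ t, fun x => ?_, upperBounds_lReg ht ht0 hcov,
    lowerBounds_lReg ht ht0 hμ hT hΛ, isGreatest_lRate⟩
  by_cases hx : x ∈ regPart X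
  · rw [lReg_of_mem hx]
    exact lZero_nonneg ht hμ x
  · rw [lReg_of_notMem hx]
    exact le_top

end Class

end LargeDev

open LargeDev in
theorem mainTheorem3 {X : Type*} [TopologicalSpace X] [MeasurableSpace X] [BorelSpace X]
    (hXK : ∀ K : Set X, IsCompact K → MeasurableSet K)
    {ι : Type*} [Preorder ι] [IsDirectedOrder ι] [Nonempty ι]
    (μ : ι → Measure X) (hμ : ∀ α, IsProbabilityMeasure (μ α))
    (t : ι → ℝ) (ht : ∀ α, 0 < t α) (ht0 : Tendsto t atTop (𝓝 0)) :
    (LargeDev.RegExpTight μ t → LargeDev.CoverCondition μ t) ∧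
    ((LargeDev.ExpTight μ t ∧ ∀ x ∉ LargeDev.regPart X, LargeDev.lZero μ t x = ⊤) →
      LargeDev.CoverCondition μ t) ∧
    ((∀ K : Set X, IsCompact K → IsClosed K) → LargeDev.RegExpTight μ t →
      (LargeDev.ExpTight μ t ∧ ∀ x ∉ LargeDev.regPart X, LargeDev.lZero μ t x = ⊤)) ∧
    (∀ T : Set (X → EReal), LargeDev.IsApproximatingClass T →
      LargeDev.CoverCondition μ t →
      (∀ h ∈ LargeDev.negPart T, LargeDev.LambdaExists μ t h) →
        LargeDev.IsLDPWithRate μ t (LargeDev.lClass μ t T) ∧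
        LargeDev.lClass μ t T = LargeDev.lClass μ t (LargeDev.negPart T) ∧
        (∀ x ∈ LargeDev.regPart X, LargeDev.lClass μ t T x =
          ⨅ (r : ℝ) (_ : 0 < r),
            ⨆ h ∈ {h ∈ LargeDev.negPart T | ((-r : ℝ) : EReal) ≤ h x},
              -LargeDev.Lambda μ t h) ∧
        (∃ L : (X → EReal) → EReal,
          (∀ h ∈ T, Tendsto (fun M : ℝ => -LargeDev.LambdaLower μ t (LargeDev.trunc h M))
            atTop (𝓝 (L h))) ∧
          ∀ x ∈ LargeDev.regPart X, LargeDev.lClass μ t T x =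
            ⨅ (r : ℝ) (_ : 0 < r), ⨆ h ∈ {h ∈ T | ((-r : ℝ) : EReal) ≤ h x}, L h) ∧
        ((∀ J₁ J₂ : X → EReal,
            LargeDev.IsLDPWithRate μ t J₁ → LargeDev.IsLDPWithRate μ t J₂ → J₁ = J₂) →
          ∀ x, LargeDev.lClass μ t T x =
            ⨆ (G : Set X) (_ : IsOpen G) (_ : x ∈ G),
              ⨅ y ∈ G ∩ LargeDev.regPart X, LargeDev.lClass μ t T y)) := by
  refine ⟨fun h => coverCondition_of_expTight ht ht0 hμ fun ε hε => ?_, fun h =>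
    coverCondition_of_expTight ht ht0 hμ fun ε hε => ?_, fun hKF h => ⟨fun ε hε => ?_, fun x hx =>
    lZero_eq_top_of_regExpTight hKF h hx⟩, fun T hT hcov hΛ => ?_⟩
  · obtain ⟨K, hK, hKX, hKε⟩ := h ε hε
    exact ⟨K, hK, hKε, fun x hxK hx => absurd (hKX hxK) hx⟩
  · obtain ⟨K, hK, hKε⟩ := h.1 ε hε
    exact ⟨K, hK, hKε, fun x _ hx => h.2 x hx⟩
  · obtain ⟨K, hK, -, hKε⟩ := h ε hε
    exact ⟨K, hK, hKε⟩
  have hrate := lClass_eq_lRate ht ht0 hμ hT hcov hΛ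
  have hreg : ∀ x ∈ regPart X, lClass μ t T x = lZero μ t x := fun x hx =>
    lClass_eq_lZero ht ht0 hμ hT hΛ hx
  refine ⟨?_, ?_, fun x hx => ?_, ⟨fun h => ⨅ M : ℝ, -LambdaLower μ t (trunc h M),
    fun h _ => tendsto_atTop_iInf (antitone_neg_LambdaLower_trunc ht h), fun x hx => ?_⟩,
    fun _ x => ?_⟩
  · rw [hrate]
    exact isLDPWithRate_lRate ht ht0 hμ hT hcov hΛ
  -- `lRate` does not involve the class, so both sides reduce to it.
  · rw [hrate, lClass_eq_lRate ht ht0 hμ hT.negPart hcov (by rwa [negPart_negPart])]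
  · rw [hreg x hx, (iInf_lambda_eq ht ht0 hμ hT hΛ hx).2]
  · rw [hreg x hx, iInf_trunc_eq_lZero ht ht0 hμ hT hΛ hx]
  · rw [hrate, lRate]
    refine iSup_congr fun G => iSup_congr fun _ => iSup_congr fun _ =>
      iInf_congr fun y => iInf_congr fun hy => (lRate_eq_lZero hy.2).symm
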